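/- Call a square matrix with non-negative real entries *primitive* if some power of it with positive integer exponent has all entries positive, and write $(0)$ for the $1\times 1$ zero matrix. For a square matrix $M$ with non-negative real entries, let $\mathsf{p}(M)$ be the least positive integer $p$ for which there is a permutation matrix $T$ such that $T^{-1}M^{p}T$ is upper or lower block triangular with each square diagonal block either primitive or equal to $(0)$ (such a $p$ always exists). Let $\mathrm{Spec}(A)$ be the multiset of complex eigenvalues of a square matrix $A$, counted with algebraic multiplicity. **Proposition.** Let $M\in\mathbb{N}^{m\times m}$. Then, for all $i,j\in\{1,\dots,m\}$ and all $r\in\{0,\dots,\mathsf{p}(M)-1\}$, either $(M^{\mathsf{p}(M)n+r})_{i,j}=0$ for all sufficiently large $n$, or there exist $\lambda\in\mathrm{Spec}(M^{\mathsf{p}(M)})\cap\mathbb{R}_{\ge 1}$ and $d\in\mathbb{N}$ such that $(M^{\mathsf{p}(M)n+r})_{i,j}=\Theta(n^{d}\lambda^{n})$ as $n\to\infty$. -/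

import Mathlib

open Filter Asymptotics

/-- The spectrum of a complex square matrix: the multiset of its eigenvalues, repeated according
to their algebraic multiplicities. -/
noncomputable def Matrix.Spec {m : ℕ} (A : Matrix (Fin m) (Fin m) ℂ) : Multiset ℂ :=
  A.charpoly.roots

/-- With respect to the block map `b` (row and column `i` belong to the block `b i`; when `b` is
monotone and surjective the blocks are nonempty consecutive intervals), `A` is upper or lower block
triangular and each of its diagonal blocks is either primitive or the `1 × 1` matrix `(0)`. -/
def Matrix.IsTriangularPrimitive {m h : ℕ} (A : Matrix (Fin m) (Fin m) ℝ) (b : Fin m → Fin h) :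
    Prop :=
  (A.BlockTriangular b ∨ A.BlockTriangular (OrderDual.toDual ∘ b)) ∧
    ∀ k : Fin h, (A.toSquareBlock b k).IsPrimitive ∨
      (Fintype.card {i // b i = k} = 1 ∧ A.toSquareBlock b k = 0)

/-- For some permutation matrix `T`, the matrix `T⁻¹ A T` is upper or lower block triangular and
each of its (square, nonempty) diagonal blocks is either primitive or `(0)`.  Conjugation by a
permutation matrix is expressed as the simultaneous permutation of rows and columns. -/
def Matrix.IsPermTriangularPrimitive {m : ℕ} (A : Matrix (Fin m) (Fin m) ℝ) : Prop :=
  ∃ (σ : Equiv.Perm (Fin m)) (h : ℕ) (b : Fin m → Fin h),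
    Monotone b ∧ Function.Surjective b ∧ (A.submatrix σ σ).IsTriangularPrimitive b

/-- For a non-negative square matrix `M`, the least positive integer `p` such that `M ^ p` is, up
to conjugation by a permutation matrix, block triangular with diagonal blocks that are primitive or
`(0)`.  Such a `p` exists: see `Matrix.isLeast_primitivePeriod`. -/
noncomputable def Matrix.primitivePeriod {m : ℕ} (M : Matrix (Fin m) (Fin m) ℝ) : ℕ :=
  sInf {p : ℕ | 0 < p ∧ (M ^ p).IsPermTriangularPrimitive}

/-- Positivity pattern of a product of non-negative matrices. -/
theorem Matrix.mul_apply_pos_iff_of_nonneg {m : ℕ} {A B : Matrix (Fin m) (Fin m) ℝ}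
    (hA : ∀ i j, 0 ≤ A i j) (hB : ∀ i j, 0 ≤ B i j) (i j : Fin m) :
    0 < (A * B) i j ↔ ∃ l, 0 < A i l ∧ 0 < B l j := by
  rw [Matrix.mul_apply, Finset.sum_pos_iff_of_nonneg fun l _ => mul_nonneg (hA i l) (hB l j)]
  constructor
  · rintro ⟨l, -, h⟩
    exact ⟨l, lt_of_le_of_ne (hA i l) fun e => by simp [← e] at h,
      lt_of_le_of_ne (hB l j) fun e => by simp [← e] at h⟩
  · rintro ⟨l, h1, h2⟩
    exact ⟨l, Finset.mem_univ l, mul_pos h1 h2⟩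

/-- Powers of a non-negative matrix are non-negative. -/
theorem Matrix.pow_apply_nonneg_of_nonneg {m : ℕ} {M : Matrix (Fin m) (Fin m) ℝ}
    (hM : ∀ i j, 0 ≤ M i j) (k : ℕ) : ∀ i j, 0 ≤ (M ^ k) i j := by
  induction k with
  | zero =>
    intro i j
    rw [pow_zero, Matrix.one_apply]
    split_ifs <;> norm_num
  | succ k ih =>
    intro i j
    rw [pow_succ, Matrix.mul_apply]
    exact Finset.sum_nonneg fun l _ => mul_nonneg (ih i l) (hM l j)

/-- Some positive power of `M` has the same positivity pattern as its square. -/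
theorem Matrix.exists_pow_pattern_idempotent {m : ℕ} {M : Matrix (Fin m) (Fin m) ℝ}
    (hM : ∀ i j, 0 ≤ M i j) :
    ∃ p : ℕ, 0 < p ∧ ∀ i j, 0 < (M ^ p * M ^ p) i j ↔ 0 < (M ^ p) i j := by
  classical
  have hn := Matrix.pow_apply_nonneg_of_nonneg hM
  let R : ℕ → Fin m → Fin m → Prop := fun k i j => 0 < (M ^ k) i j
  have hR : ∀ a b i j, R (a + b) i j ↔ ∃ l, R a i l ∧ R b l j := fun a b i j => by
    simp only [R, pow_add, Matrix.mul_apply_pos_iff_of_nonneg (hn a) (hn b)]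
  obtain ⟨x, y, hxy, hRxy⟩ : ∃ x y, x < y ∧ R (x + 1) = R (y + 1) := by
    obtain ⟨x, y, hne, he⟩ := Finite.exists_ne_map_eq_of_infinite (fun k => R (k + 1))
    rcases lt_or_gt_of_ne hne with h | h
    · exact ⟨x, y, h, he⟩
    · exact ⟨y, x, h, he.symm⟩
  have step : ∀ n, x + 1 ≤ n → R (n + (y - x)) = R n := by
    intro n hn
    obtain ⟨t, rfl⟩ := Nat.exists_eq_add_of_le hn
    have e : x + 1 + t + (y - x) = (y + 1) + t := by omega
    funext i j
    rw [e]
    exact propext (by rw [hR, hR, hRxy])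
  have steps : ∀ k n, x + 1 ≤ n → R (n + k * (y - x)) = R n := by
    intro k
    induction k with
    | zero => intro n _; simp
    | succ k ih =>
      intro n hn
      rw [Nat.succ_mul, ← Nat.add_assoc, step _ (by omega), ih n hn]
  have hc : 1 ≤ y - x := by omega
  have hle : x + 1 ≤ (x + 1) * (y - x) := Nat.le_mul_of_pos_right _ hc
  refine ⟨(x + 1) * (y - x), by omega, fun i j => ?_⟩
  rw [← pow_add]
  exact iff_of_eq (congrFun (congrFun (steps (x + 1) _ hle) i) j)

/-- For every non-negative square matrix, the least exponent exists. -/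
theorem Matrix.isLeast_primitivePeriod {m : ℕ} {M : Matrix (Fin m) (Fin m) ℝ}
    (hM : ∀ i j, 0 ≤ M i j) :
    IsLeast {p : ℕ | 0 < p ∧ (M ^ p).IsPermTriangularPrimitive} M.primitivePeriod := by
  classical
  suffices h : {p : ℕ | 0 < p ∧ (M ^ p).IsPermTriangularPrimitive}.Nonempty from
    ⟨Nat.sInf_mem h, fun _ hp => Nat.sInf_le hp⟩
  obtain ⟨p, hp, hid⟩ := Matrix.exists_pow_pattern_idempotent hM
  refine ⟨p, hp, ?_⟩
  have hA := Matrix.pow_apply_nonneg_of_nonneg hM p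
  generalize M ^ p = A at hid hA
  have htr : ∀ {i j k}, 0 < A i j → 0 < A j k → 0 < A i k := fun {i j k} h1 h2 =>
    (hid i k).1 ((Matrix.mul_apply_pos_iff_of_nonneg hA hA _ _).2 ⟨j, h1, h2⟩)
  -- the vertices, preordered by reachability
  obtain ⟨h, c, hcs, hle, hcl⟩ : ∃ (h : ℕ) (c : Fin m → Fin h), Function.Surjective c ∧
      (∀ i j, 0 < A i j → c i ≤ c j) ∧ (∀ i j, c i = c j → i = j ∨ 0 < A i j) := by
    have key : ∀ (α : Type) [Fintype α] [Preorder α], ∃ (h : ℕ) (c : α → Fin h),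
        Function.Surjective c ∧ (∀ i j : α, i ≤ j → c i ≤ c j) ∧
          (∀ i j : α, c i = c j → i ≤ j) := by
      intro α _ _
      let L := LinearExtension (Antisymmetrization α (· ≤ ·))
      have hs : Function.Surjective (toAntisymmetrization (α := α) (· ≤ ·)) := fun q =>
        Quotient.inductionOn' (s₁ := AntisymmRel.setoid α (· ≤ ·)) q fun a => ⟨a, rfl⟩
      have : Finite (Antisymmetrization α (· ≤ ·)) := Finite.of_surjective _ hs
      have : Fintype (Antisymmetrization α (· ≤ ·)) := Fintype.ofFinite _
      let _ : Fintype L := this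
      let e : Fin (Fintype.card L) ≃o L := Fintype.orderIsoFinOfCardEq L rfl
      let g : α → L := fun a => toLinearExtension (toAntisymmetrization (· ≤ ·) a)
      refine ⟨_, fun a => e.symm (g a), ?_, ?_, ?_⟩
      · exact e.symm.surjective.comp hs
      · intro i j hij
        exact e.symm.monotone (toLinearExtension.monotone (toAntisymmetrization_mono hij))
      · intro i j hij
        have h1 : g i = g j := e.symm.injective hij
        have h2 : toAntisymmetrization (α := α) (· ≤ ·) i = toAntisymmetrization (· ≤ ·) j := h1
        exact (Quotient.exact h2).1
    let P : Preorder (Fin m) :=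
      { le := fun i j => i = j ∨ 0 < A i j
        lt := fun i j => (i = j ∨ 0 < A i j) ∧ ¬ (j = i ∨ 0 < A j i)
        lt_iff_le_not_ge := fun _ _ => Iff.rfl
        le_refl := fun i => Or.inl rfl
        le_trans := by
          rintro i j k (rfl | h1) (rfl | h2)
          · exact Or.inl rfl
          · exact Or.inr h2
          · exact Or.inr h1
          · exact Or.inr (htr h1 h2) }
    obtain ⟨h, c, h1, h2, h3⟩ := @key (Fin m) _ P
    exact ⟨h, c, h1, fun i j hij => h2 i j (Or.inr hij), h3⟩
  refine ⟨Tuple.sort c, h, c ∘ Tuple.sort c, Tuple.monotone_sort c,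
    hcs.comp (Tuple.sort c).surjective, Or.inl ?_, ?_⟩
  · intro i j hij
    by_contra hne
    exact absurd (hle _ _ (lt_of_le_of_ne (hA _ _) (Ne.symm hne))) (not_le.2 hij)
  · intro k
    generalize Tuple.sort c = σ
    by_cases hk : ∃ i, c (σ i) = k ∧ 0 < A (σ i) (σ i)
    · obtain ⟨i, rfl, hi⟩ := hk
      refine Or.inl ⟨fun a b => hA _ _, 1, one_pos, ?_⟩
      rintro ⟨a, ha⟩ ⟨b, hb⟩
      rw [pow_one]
      change 0 < A (σ a) (σ b)
      simp only [Function.comp_apply] at ha hb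
      rcases hcl _ _ ha with e | h1
      · rw [e]
        rcases hcl _ _ hb.symm with e' | h2
        · rw [← e']; exact hi
        · exact h2
      · rcases hcl _ _ hb.symm with e' | h2
        · rw [← e']; exact h1
        · exact htr h1 h2
    · push Not at hk
      have heq : ∀ a b, c (σ a) = k → c (σ b) = k → a = b := by
        intro a b ha hb
        rcases hcl _ _ (ha.trans hb.symm) with e | h1
        · exact σ.injective e
        · rcases hcl _ _ (hb.trans ha.symm) with e | h2
          · exact (σ.injective e).symm
          · exact absurd (htr h1 h2) (not_lt.2 (hk a ha))
      refine Or.inr ⟨?_, ?_⟩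
      · obtain ⟨v, hv⟩ := hcs k
        rw [Fintype.card_eq_one_iff]
        exact ⟨⟨σ.symm v, by simpa using hv⟩, fun y => Subtype.ext (heq _ _ y.2 (by simpa using hv))⟩
      · ext ⟨a, ha⟩ ⟨b, hb⟩
        obtain rfl := heq a b ha hb
        exact le_antisymm (hk a ha) (hA _ _)

/-! By the choice of p, M^p is, up to a simultaneous permutation, block triangular with primitive or
zero diagonal blocks. A primitive block has a positive eigenvector with eigenvalue μ > 0, and all
entries of its n-th power are of exact order μ^n. Integrality forces μ ≥ 1, and triangularity makes
μ an eigenvalue of the whole matrix.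

An off-diagonal entry of a power is a sum over paths. Splitting a path at its first exit from the
initial block (`Matrix.pow_succ_eq_add_sum_antidiagonal`) writes the entry as a nonnegative
combination of convolutions: powers of that block against entries of powers whose row lies in a
strictly later block. So it suffices that the sequences which are eventually zero or of order n^d
lam^n, with lam an admissible eigenvalue, are closed under sums, nonnegative multiples and
convolutions (`IsZeroOrHasGrowth.conv`). In a convolution the larger rate wins; equal rates add the
degrees plus one. Induction over the blocks concludes, and the remainder r only adds the factor M^r.

The weight (n + 1)^d replaces n^d so that the upper bound can hold from n = 0 on; convolutions
involve every index. -/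

/-! ### Sequences of order n^d lam^n -/

/-- `f` is bounded above by a multiple of `(n + 1) ^ d * lam ^ n` everywhere and below by a positive
multiple of it eventually. -/
structure HasGrowth (f : ℕ → ℝ) (d : ℕ) (lam : ℝ) : Prop where
  upper : ∃ C, 0 < C ∧ ∀ n : ℕ, f n ≤ C * (((n : ℝ) + 1) ^ d * lam ^ n)
  lower : ∃ c, 0 < c ∧ ∃ N : ℕ, ∀ n, N ≤ n → c * (((n : ℝ) + 1) ^ d * lam ^ n) ≤ f n

/-- A nonnegative sequence that is eventually zero or grows like `n ^ d * lam ^ n` for some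
`lam ∈ Λ`. -/
structure IsZeroOrHasGrowth (Λ : Set ℝ) (f : ℕ → ℝ) : Prop where
  nonneg : ∀ n, 0 ≤ f n
  zero_or_growth : (∀ᶠ n in atTop, f n = 0) ∨ ∃ lam ∈ Λ, ∃ d, HasGrowth f d lam

/-- Lets an eventually zero sequence be treated as one of arbitrarily small exponential rate. -/
theorem exists_bound_of_eventually_zero {f : ℕ → ℝ} (hf : ∀ᶠ n in atTop, f n = 0) {μ : ℝ}
    (hμ : 0 < μ) : ∃ K, 0 < K ∧ ∀ n, f n ≤ K * μ ^ n := by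
  obtain ⟨N, hN⟩ := eventually_atTop.1 hf
  have hs : ∀ n, 0 ≤ |f n| / μ ^ n := fun n => by positivity
  -- The sum dominates each of the ratios before N; the 1 only makes the constant positive.
  refine ⟨1 + ∑ k ∈ Finset.range N, |f k| / μ ^ k,
    add_pos_of_pos_of_nonneg one_pos (Finset.sum_nonneg fun k _ => hs k), fun n => ?_⟩
  have hp : 0 < μ ^ n := pow_pos hμ n
  rcases lt_or_ge n N with h | h
  · rw [← div_le_iff₀ hp]
    have h1 : |f n| / μ ^ n ≤ ∑ k ∈ Finset.range N, |f k| / μ ^ k :=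
      Finset.single_le_sum (f := fun k => |f k| / μ ^ k) (fun k _ => hs k) (Finset.mem_range.2 h)
    have h2 : f n / μ ^ n ≤ |f n| / μ ^ n := by gcongr; exact le_abs_self _
    linarith
  · rw [hN n h]
    have := Finset.sum_nonneg (s := Finset.range N) fun k _ => hs k
    positivity

theorem exists_bound_polynomial_mul_pow (e : ℕ) {μ lam : ℝ} (hμ : 0 ≤ μ) (h : μ < lam) :
    ∃ K, 0 < K ∧ ∀ n : ℕ, ((n : ℝ) + 1) ^ e * μ ^ n ≤ K * lam ^ n := by
  have hl : 0 < lam := hμ.trans_lt h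
  have ht : Tendsto (fun n : ℕ => (n : ℝ) ^ e * (μ / lam) ^ n) atTop (nhds 0) :=
    tendsto_pow_const_mul_const_pow_of_abs_lt_one e (by
      rw [abs_of_nonneg (by positivity), div_lt_one hl]; exact h)
  obtain ⟨K, hK⟩ := ht.bddAbove_range
  have hK' : ∀ n : ℕ, (n : ℝ) ^ e * (μ / lam) ^ n ≤ K := fun n => hK ⟨n, rfl⟩
  have hK0 : 0 ≤ K := le_trans (by positivity) (hK' 1)
  -- The factor 2 ^ e comes from n + 1 ≤ 2n for n ≥ 1; the added 1 covers n = 0.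
  refine ⟨2 ^ e * K + 1, by positivity, fun n => ?_⟩
  have hp : 0 < lam ^ n := pow_pos hl n
  rw [← div_le_iff₀ hp, mul_div_assoc, ← div_pow]
  rcases Nat.eq_zero_or_pos n with rfl | hn
  · simp only [Nat.cast_zero, zero_add, one_pow, pow_zero, mul_one]
    have : 0 ≤ 2 ^ e * K := by positivity
    linarith
  · have hn' : (1 : ℝ) ≤ n := by exact_mod_cast hn
    calc ((n : ℝ) + 1) ^ e * (μ / lam) ^ n ≤ (2 * n) ^ e * (μ / lam) ^ n := by
          gcongr; linarith
      _ = 2 ^ e * ((n : ℝ) ^ e * (μ / lam) ^ n) := by ring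
      _ ≤ 2 ^ e * K + 1 := by nlinarith [hK' n, pow_pos (two_pos (α := ℝ)) e]

/-! ### Sums, convolutions and shifts of such sequences -/

namespace HasGrowth

variable {f g : ℕ → ℝ} {d e : ℕ} {lam μ : ℝ}

theorem add_of_bound (hf : HasGrowth f d lam) (hg0 : ∀ n, 0 ≤ g n) {K : ℝ} (hK : 0 < K)
    (hg : ∀ n : ℕ, g n ≤ K * (((n : ℝ) + 1) ^ d * lam ^ n)) :
    HasGrowth (fun n => f n + g n) d lam := by
  obtain ⟨C, hC, hu⟩ := hf.upper
  obtain ⟨c, hc, N, hl⟩ := hf.lower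
  exact ⟨⟨C + K, by positivity, fun n => by linarith [hu n, hg n]⟩,
    ⟨c, hc, N, fun n hn => by linarith [hl n hn, hg0 n]⟩⟩

theorem add_of_le (hf : HasGrowth f d lam) (hlam : 0 < lam) (hg0 : ∀ n, 0 ≤ g n)
    (hg : HasGrowth g e lam) (hed : e ≤ d) : HasGrowth (fun n => f n + g n) d lam := by
  obtain ⟨K, hK, hu⟩ := hg.upper
  refine hf.add_of_bound hg0 hK fun n => (hu n).trans ?_
  have : (1 : ℝ) ≤ (n : ℝ) + 1 := by linarith [n.cast_nonneg (α := ℝ)]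
  gcongr

theorem exists_pow_bound (hg : HasGrowth g e μ) (hμ : 0 ≤ μ) (h : μ < lam) :
    ∃ K, 0 < K ∧ ∀ n : ℕ, g n ≤ K * lam ^ n := by
  obtain ⟨K, hK, hu⟩ := hg.upper
  obtain ⟨K', hK', hu'⟩ := exists_bound_polynomial_mul_pow e hμ h
  refine ⟨K * K', by positivity, fun n => (hu n).trans ?_⟩
  rw [mul_assoc]
  exact mul_le_mul_of_nonneg_left (hu' n) hK.le

theorem add_of_pow_bound (hf : HasGrowth f d lam) (hlam : 0 < lam) (hg0 : ∀ n, 0 ≤ g n)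
    {K : ℝ} (hK : 0 < K) (hg : ∀ n : ℕ, g n ≤ K * lam ^ n) :
    HasGrowth (fun n => f n + g n) d lam := by
  refine hf.add_of_bound hg0 hK fun n => (hg n).trans ?_
  have h1 : (1 : ℝ) ≤ ((n : ℝ) + 1) ^ d :=
    one_le_pow₀ (by linarith [n.cast_nonneg (α := ℝ)])
  gcongr
  exact le_mul_of_one_le_left (by positivity) h1

/-- All n + 1 terms are at most of order n^(d+e) lam^n, and the terms in the middle third attain
that order; hence the extra degree. -/
theorem conv_of_eq (hf : HasGrowth f d lam) (hg : HasGrowth g e lam) (hlam : 0 < lam)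
    (hf0 : ∀ n, 0 ≤ f n) (hg0 : ∀ n, 0 ≤ g n) :
    HasGrowth (fun n => ∑ x ∈ Finset.HasAntidiagonal.antidiagonal n, f x.1 * g x.2)
      (d + e + 1) lam := by
  obtain ⟨C, hC, hu⟩ := hf.upper
  obtain ⟨c, hc, N, hl⟩ := hf.lower
  obtain ⟨C', hC', hu'⟩ := hg.upper
  obtain ⟨c', hc', N', hl'⟩ := hg.lower
  refine ⟨⟨C * C', by positivity, fun n => ?_⟩,
    ⟨c * c' * (1 / 3) ^ (d + e + 1), by positivity, 3 * (N + N'), fun n hn => ?_⟩⟩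
  · calc ∑ x ∈ Finset.HasAntidiagonal.antidiagonal n, f x.1 * g x.2
        ≤ ∑ x ∈ Finset.HasAntidiagonal.antidiagonal n,
            C * C' * (((n : ℝ) + 1) ^ (d + e) * lam ^ n) := by
          refine Finset.sum_le_sum fun x hx => ?_
          rw [Finset.HasAntidiagonal.mem_antidiagonal] at hx
          have h1 : (x.1 : ℝ) ≤ n := by exact_mod_cast (by omega : x.1 ≤ n)
          have h2 : (x.2 : ℝ) ≤ n := by exact_mod_cast (by omega : x.2 ≤ n)
          calc f x.1 * g x.2 ≤ (C * (((x.1 : ℝ) + 1) ^ d * lam ^ x.1)) *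
                (C' * (((x.2 : ℝ) + 1) ^ e * lam ^ x.2)) :=
                mul_le_mul (hu _) (hu' _) (hg0 _) (by positivity)
            _ ≤ (C * (((n : ℝ) + 1) ^ d * lam ^ x.1)) *
                (C' * (((n : ℝ) + 1) ^ e * lam ^ x.2)) := by gcongr
            _ = C * C' * (((n : ℝ) + 1) ^ (d + e) * lam ^ n) := by rw [← hx]; ring
      _ = C * C' * (((n : ℝ) + 1) ^ (d + e + 1) * lam ^ n) := by
          rw [Finset.sum_const, Finset.Nat.card_antidiagonal, nsmul_eq_mul]
          push_cast
          ring
  · rw [Finset.Nat.sum_antidiagonal_eq_sum_range_succ (fun a b => f a * g b)]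
    -- For k in [q, 2q] both k and n - k are at least q, and n ≥ 3(N + N') gives q ≥ N + N', so both
    -- lower bounds apply.
    obtain ⟨q, hq1, hq2⟩ : ∃ q, 3 * q ≤ n ∧ n + 1 ≤ 3 * (q + 1) := ⟨n / 3, by omega, by omega⟩
    have hq : ((n : ℝ) + 1) * (1 / 3) ≤ (q : ℝ) + 1 := by
      have : (n : ℝ) + 1 ≤ 3 * ((q : ℝ) + 1) := by exact_mod_cast hq2
      linarith
    calc c * c' * (1 / 3) ^ (d + e + 1) * (((n : ℝ) + 1) ^ (d + e + 1) * lam ^ n)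
        = c * c' * (((n : ℝ) + 1) * (1 / 3)) ^ (d + e + 1) * lam ^ n := by rw [mul_pow]; ring
      _ ≤ c * c' * ((q : ℝ) + 1) ^ (d + e + 1) * lam ^ n := by gcongr
      _ = ∑ k ∈ Finset.Icc q (2 * q), c * c' * ((q : ℝ) + 1) ^ (d + e) * lam ^ n := by
          rw [Finset.sum_const, Nat.card_Icc, nsmul_eq_mul,
            show 2 * q + 1 - q = q + 1 by omega]
          push_cast
          ring
      _ ≤ ∑ k ∈ Finset.Icc q (2 * q), f k * g (n - k) := by
          refine Finset.sum_le_sum fun k hk => ?_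
          rw [Finset.mem_Icc] at hk
          have h1 : (q : ℝ) ≤ k := by exact_mod_cast hk.1
          have h2 : (q : ℝ) ≤ (n - k : ℕ) := by exact_mod_cast (by omega : q ≤ n - k)
          calc c * c' * ((q : ℝ) + 1) ^ (d + e) * lam ^ n
              = (c * (((q : ℝ) + 1) ^ d * lam ^ k)) *
                (c' * (((q : ℝ) + 1) ^ e * lam ^ (n - k))) := by
                rw [show n = k + (n - k) by omega, pow_add, pow_add, Nat.add_sub_cancel_left]
                ring
            _ ≤ (c * (((k : ℝ) + 1) ^ d * lam ^ k)) *
                (c' * ((((n - k : ℕ) : ℝ) + 1) ^ e * lam ^ (n - k))) := by gcongr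
            _ ≤ f k * g (n - k) :=
                mul_le_mul (hl _ (by omega)) (hl' _ (by omega)) (by positivity) (hf0 _)
      _ ≤ ∑ k ∈ Finset.range n.succ, f k * g (n - k) := by
          refine Finset.sum_le_sum_of_subset_of_nonneg (fun k hk => ?_)
            fun k _ _ => mul_nonneg (hf0 _) (hg0 _)
          rw [Finset.mem_Icc] at hk
          rw [Finset.mem_range]
          omega

/-- Relative to the order of f, the terms decay geometrically with ratio μ / lam, which gives the
upper bound. For the lower bound the single term (n - m, m) with g m > 0 suffices. -/
theorem conv_of_pow_bound (hf : HasGrowth f d lam) (hμ : 0 < μ) (hμl : μ < lam)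
    (hf0 : ∀ n, 0 ≤ f n) (hg0 : ∀ n, 0 ≤ g n) {K : ℝ} (hK : 0 < K)
    (hg : ∀ n : ℕ, g n ≤ K * μ ^ n) {m : ℕ} (hm : 0 < g m) :
    HasGrowth (fun n => ∑ x ∈ Finset.HasAntidiagonal.antidiagonal n, f x.1 * g x.2) d lam := by
  have hlam : 0 < lam := hμ.trans hμl
  obtain ⟨C, hC, hu⟩ := hf.upper
  obtain ⟨c, hc, N, hl⟩ := hf.lower
  have hr0 : 0 ≤ μ / lam := by positivity
  have hr1 : μ / lam < 1 := (div_lt_one hlam).2 hμl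
  have hS := summable_geometric_of_lt_one hr0 hr1
  have hS0 : 0 < ∑' l : ℕ, (μ / lam) ^ l := by
    rw [tsum_geometric_of_lt_one hr0 hr1]
    exact inv_pos.2 (by linarith)
  refine ⟨⟨C * K * ∑' l : ℕ, (μ / lam) ^ l, by positivity, fun n => ?_⟩,
    ⟨c * ((m : ℝ) + 1)⁻¹ ^ d * (lam ^ m)⁻¹ * g m, by positivity, N + m, fun n hn => ?_⟩⟩
  · calc ∑ x ∈ Finset.HasAntidiagonal.antidiagonal n, f x.1 * g x.2
        ≤ ∑ x ∈ Finset.HasAntidiagonal.antidiagonal n,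
            C * K * (((n : ℝ) + 1) ^ d * lam ^ n) * (μ / lam) ^ x.2 := by
          refine Finset.sum_le_sum fun x hx => ?_
          rw [Finset.HasAntidiagonal.mem_antidiagonal] at hx
          have h1 : (x.1 : ℝ) ≤ n := by exact_mod_cast (by omega : x.1 ≤ n)
          calc f x.1 * g x.2 ≤ (C * (((x.1 : ℝ) + 1) ^ d * lam ^ x.1)) * (K * μ ^ x.2) :=
                mul_le_mul (hu _) (hg _) (hg0 _) (by positivity)
            _ ≤ (C * (((n : ℝ) + 1) ^ d * lam ^ x.1)) * (K * μ ^ x.2) := by gcongr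
            _ = C * K * (((n : ℝ) + 1) ^ d * lam ^ n) * (μ / lam) ^ x.2 := by
                rw [← hx, pow_add, div_pow]
                field_simp
      _ = C * K * (((n : ℝ) + 1) ^ d * lam ^ n) *
            ∑ x ∈ Finset.HasAntidiagonal.antidiagonal n, (μ / lam) ^ x.2 := by rw [Finset.mul_sum]
      _ ≤ C * K * (((n : ℝ) + 1) ^ d * lam ^ n) * ∑' l : ℕ, (μ / lam) ^ l := by
          gcongr
          rw [← Finset.Nat.sum_antidiagonal_swap]
          simp only [Prod.snd_swap]
          rw [Finset.Nat.sum_antidiagonal_eq_sum_range_succ (fun a _ => (μ / lam) ^ a)]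
          exact hS.sum_le_tsum _ fun l _ => pow_nonneg hr0 l
      _ = _ := by ring
  · have h1 : (n : ℝ) + 1 ≤ ((m : ℝ) + 1) * (((n - m : ℕ) : ℝ) + 1) := by
      rw [Nat.cast_sub (by omega)]
      have : (m : ℝ) ≤ n := by exact_mod_cast (by omega : m ≤ n)
      nlinarith [m.cast_nonneg (α := ℝ)]
    calc c * ((m : ℝ) + 1)⁻¹ ^ d * (lam ^ m)⁻¹ * g m * (((n : ℝ) + 1) ^ d * lam ^ n)
        = c * ((((n : ℝ) + 1) / ((m : ℝ) + 1)) ^ d * lam ^ (n - m)) * g m := by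
          rw [show lam ^ n = lam ^ (n - m) * lam ^ m by rw [← pow_add]; congr 1; omega,
            div_pow, inv_pow]
          field_simp
      _ ≤ c * ((((n - m : ℕ) : ℝ) + 1) ^ d * lam ^ (n - m)) * g m := by
          gcongr
          rw [div_le_iff₀ (by positivity)]
          linarith
      _ ≤ f (n - m) * g m := by
          gcongr
          exact hl _ (by omega)
      _ ≤ ∑ x ∈ Finset.HasAntidiagonal.antidiagonal n, f x.1 * g x.2 :=
          Finset.single_le_sum (f := fun x : ℕ × ℕ => f x.1 * g x.2)
            (fun x _ => mul_nonneg (hf0 _) (hg0 _))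
            (Finset.HasAntidiagonal.mem_antidiagonal.2 (by omega : (n - m, m).1 + (n - m, m).2 = n))

/-- The path expansion describes the powers n + 1, so the index has to be shifted back. -/
theorem of_succ (hf : HasGrowth (fun n => f (n + 1)) d lam) (hlam : 0 < lam) :
    HasGrowth f d lam := by
  obtain ⟨C, hC, hu⟩ := hf.upper
  obtain ⟨c, hc, N, hl⟩ := hf.lower
  -- The summand |f 0| handles n = 0; the factor (1 / 2) ^ d compensates for n + 2 ≤ 2(n + 1).
  refine ⟨⟨C / lam + |f 0|, by positivity, fun n => ?_⟩,
    ⟨c / lam * (1 / 2) ^ d, by positivity, N + 1, fun n hn => ?_⟩⟩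
  · cases n with
    | zero =>
      have : 0 < C / lam := by positivity
      simp only [Nat.cast_zero, zero_add, one_pow, pow_zero, mul_one]
      linarith [le_abs_self (f 0)]
    | succ n =>
      calc f (n + 1) ≤ C * (((n : ℝ) + 1) ^ d * lam ^ n) := hu n
        _ = C / lam * (((n : ℝ) + 1) ^ d * lam ^ (n + 1)) := by rw [pow_succ]; field_simp
        _ ≤ (C / lam + |f 0|) * ((((n + 1 : ℕ) : ℝ) + 1) ^ d * lam ^ (n + 1)) := by
            gcongr
            · linarith [abs_nonneg (f 0)]
            · exact n.le_succ
  · obtain ⟨n, rfl⟩ : ∃ k, n = k + 1 := ⟨n - 1, by omega⟩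
    calc c / lam * (1 / 2) ^ d * ((((n + 1 : ℕ) : ℝ) + 1) ^ d * lam ^ (n + 1))
        = c * ((1 / 2 * (((n + 1 : ℕ) : ℝ) + 1)) ^ d * lam ^ n) := by
          rw [mul_pow, pow_succ lam]
          field_simp
      _ ≤ c * (((n : ℝ) + 1) ^ d * lam ^ n) := by
          gcongr
          rw [Nat.cast_succ]
          linarith [n.cast_nonneg (α := ℝ)]
      _ ≤ f (n + 1) := hl n (by omega)

theorem const_mul (hf : HasGrowth f d lam) {a : ℝ} (ha : 0 < a) :
    HasGrowth (fun n => a * f n) d lam := by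
  obtain ⟨C, hC, hu⟩ := hf.upper
  obtain ⟨c, hc, N, hl⟩ := hf.lower
  refine ⟨⟨a * C, by positivity, fun n => ?_⟩, ⟨a * c, by positivity, N, fun n hn => ?_⟩⟩
  · rw [mul_assoc]; exact mul_le_mul_of_nonneg_left (hu n) ha.le
  · rw [mul_assoc]; exact mul_le_mul_of_nonneg_left (hl n hn) ha.le

theorem isTheta (hf : HasGrowth f d lam) (hlam : 0 < lam) (hf0 : ∀ n, 0 ≤ f n) :
    f =Θ[atTop] fun n : ℕ => (n : ℝ) ^ d * lam ^ n := by
  obtain ⟨C, hC, hu⟩ := hf.upper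
  obtain ⟨c, hc, N, hl⟩ := hf.lower
  refine ⟨IsBigO.of_bound (C * 2 ^ d) ?_, IsBigO.of_bound c⁻¹ ?_⟩
  · filter_upwards [eventually_ge_atTop 1] with n hn
    have hn' : (1 : ℝ) ≤ n := by exact_mod_cast hn
    rw [Real.norm_of_nonneg (hf0 n), Real.norm_of_nonneg (by positivity)]
    calc f n ≤ C * (((n : ℝ) + 1) ^ d * lam ^ n) := hu n
      _ ≤ C * ((2 * n) ^ d * lam ^ n) := by gcongr; linarith
      _ = _ := by rw [mul_pow]; ring
  · filter_upwards [eventually_ge_atTop N] with n hn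
    rw [Real.norm_of_nonneg (hf0 n), Real.norm_of_nonneg (by positivity), ← div_eq_inv_mul,
      le_div_iff₀ hc, mul_comm]
    refine le_trans ?_ (hl n hn)
    gcongr
    linarith

end HasGrowth

/-! ### Closure properties of the class of eventually zero or growing sequences -/

namespace IsZeroOrHasGrowth

variable {Λ : Set ℝ} {f g : ℕ → ℝ}

theorem zero : IsZeroOrHasGrowth Λ fun _ => 0 :=
  ⟨fun _ => le_rfl, Or.inl (Eventually.of_forall fun _ => rfl)⟩

theorem add (hΛ : ∀ lam ∈ Λ, 0 < lam) (hf : IsZeroOrHasGrowth Λ f)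
    (hg : IsZeroOrHasGrowth Λ g) : IsZeroOrHasGrowth Λ fun n => f n + g n := by
  refine ⟨fun n => add_nonneg (hf.nonneg n) (hg.nonneg n), ?_⟩
  rcases hf.zero_or_growth with h | ⟨lam, hlam, d, h⟩ <;>
    rcases hg.zero_or_growth with h' | ⟨μ, hμ, e, h'⟩
  · left
    filter_upwards [h, h'] with n h1 h2
    rw [h1, h2, add_zero]
  · obtain ⟨K, hK, hb⟩ := exists_bound_of_eventually_zero h (hΛ μ hμ)
    refine Or.inr ⟨μ, hμ, e, ?_⟩
    simpa only [add_comm] using h'.add_of_pow_bound (hΛ μ hμ) hf.nonneg hK hb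
  · obtain ⟨K, hK, hb⟩ := exists_bound_of_eventually_zero h' (hΛ lam hlam)
    exact Or.inr ⟨lam, hlam, d, h.add_of_pow_bound (hΛ lam hlam) hg.nonneg hK hb⟩
  · right
    rcases lt_trichotomy lam μ with hlt | rfl | hlt
    · obtain ⟨K, hK, hb⟩ := h.exists_pow_bound (hΛ lam hlam).le hlt
      refine ⟨μ, hμ, e, ?_⟩
      simpa only [add_comm] using h'.add_of_pow_bound (hΛ μ hμ) hf.nonneg hK hb
    · rcases le_total e d with hed | hed
      · exact ⟨lam, hlam, d, h.add_of_le (hΛ lam hlam) hg.nonneg h' hed⟩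
      · refine ⟨lam, hlam, e, ?_⟩
        simpa only [add_comm] using h'.add_of_le (hΛ lam hlam) hf.nonneg h hed
    · obtain ⟨K, hK, hb⟩ := h'.exists_pow_bound (hΛ μ hμ).le hlt
      exact ⟨lam, hlam, d, h.add_of_pow_bound (hΛ lam hlam) hg.nonneg hK hb⟩

theorem const_mul (hf : IsZeroOrHasGrowth Λ f) {a : ℝ} (ha : 0 ≤ a) :
    IsZeroOrHasGrowth Λ fun n => a * f n := by
  rcases ha.eq_or_lt with rfl | ha'
  · simpa only [zero_mul] using zero
  · refine ⟨fun n => mul_nonneg ha (hf.nonneg n), ?_⟩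
    rcases hf.zero_or_growth with h | ⟨lam, hlam, d, h⟩
    · left
      filter_upwards [h] with n hn
      rw [hn, mul_zero]
    · exact Or.inr ⟨lam, hlam, d, h.const_mul ha'⟩

theorem sum (hΛ : ∀ lam ∈ Λ, 0 < lam) {ι : Type*} (s : Finset ι) {F : ι → ℕ → ℝ}
    (hF : ∀ i ∈ s, IsZeroOrHasGrowth Λ (F i)) :
    IsZeroOrHasGrowth Λ fun n => ∑ i ∈ s, F i n := by
  classical
  induction s using Finset.induction_on with
  | empty => simpa only [Finset.sum_empty] using zero
  | insert a s ha ih =>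
    simp only [Finset.sum_insert ha]
    exact add hΛ (hF a (Finset.mem_insert_self a s))
      (ih fun i hi => hF i (Finset.mem_insert_of_mem hi))

theorem of_succ (hΛ : ∀ lam ∈ Λ, 0 < lam) (h0 : 0 ≤ f 0)
    (hf : IsZeroOrHasGrowth Λ fun n => f (n + 1)) : IsZeroOrHasGrowth Λ f := by
  refine ⟨fun n => by cases n with
    | zero => exact h0
    | succ n => exact hf.nonneg n, ?_⟩
  rcases hf.zero_or_growth with h | ⟨lam, hlam, d, h⟩
  · obtain ⟨N, hN⟩ := eventually_atTop.1 h
    refine Or.inl (eventually_atTop.2 ⟨N + 1, fun n hn => ?_⟩)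
    obtain ⟨n, rfl⟩ : ∃ k, n = k + 1 := ⟨n - 1, by omega⟩
    exact hN n (by omega)
  · exact Or.inr ⟨lam, hlam, d, h.of_succ (hΛ lam hlam)⟩

theorem conv_of_growth_of_bound {d : ℕ} {lam μ K : ℝ} (hf0 : ∀ n, 0 ≤ f n) (hg0 : ∀ n, 0 ≤ g n)
    (hlam : lam ∈ Λ) (hf : HasGrowth f d lam) (hμ : 0 < μ) (hμl : μ < lam) (hK : 0 < K)
    (hg : ∀ n : ℕ, g n ≤ K * μ ^ n) :
    IsZeroOrHasGrowth Λ fun n => ∑ x ∈ Finset.HasAntidiagonal.antidiagonal n, f x.1 * g x.2 := by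
  by_cases hz : ∀ n, g n = 0
  · simpa only [hz, mul_zero, Finset.sum_const_zero] using zero
  · push Not at hz
    obtain ⟨m, hm⟩ := hz
    exact ⟨fun n => Finset.sum_nonneg fun x _ => mul_nonneg (hf0 _) (hg0 _),
      Or.inr ⟨lam, hlam, d, hf.conv_of_pow_bound hμ hμl hf0 hg0 hK hg
        (lt_of_le_of_ne (hg0 m) hm.symm)⟩⟩

theorem conv (hΛ : ∀ lam ∈ Λ, 0 < lam) (hf : IsZeroOrHasGrowth Λ f)
    (hg : IsZeroOrHasGrowth Λ g) :
    IsZeroOrHasGrowth Λ fun n => ∑ x ∈ Finset.HasAntidiagonal.antidiagonal n, f x.1 * g x.2 := by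
  have hswap : (fun n => ∑ x ∈ Finset.HasAntidiagonal.antidiagonal n, f x.1 * g x.2) =
      fun n => ∑ x ∈ Finset.HasAntidiagonal.antidiagonal n, g x.1 * f x.2 := by
    funext n
    rw [← Finset.Nat.sum_antidiagonal_swap]
    exact Finset.sum_congr rfl fun x _ => mul_comm _ _
  rcases hf.zero_or_growth with h | ⟨lam, hlam, d, h⟩ <;>
    rcases hg.zero_or_growth with h' | ⟨μ, hμ, e, h'⟩
  · refine ⟨fun n => Finset.sum_nonneg fun x _ => mul_nonneg (hf.nonneg _) (hg.nonneg _),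
      Or.inl ?_⟩
    obtain ⟨N, hN⟩ := eventually_atTop.1 h
    obtain ⟨N', hN'⟩ := eventually_atTop.1 h'
    filter_upwards [eventually_ge_atTop (N + N')] with n hn
    refine Finset.sum_eq_zero fun x hx => ?_
    rw [Finset.HasAntidiagonal.mem_antidiagonal] at hx
    rcases le_total N x.1 with h1 | h1
    · rw [hN _ h1, zero_mul]
    · rw [hN' _ (by omega), mul_zero]
  · obtain ⟨K, hK, hb⟩ := exists_bound_of_eventually_zero h (half_pos (hΛ μ hμ))
    rw [hswap]
    exact conv_of_growth_of_bound hg.nonneg hf.nonneg hμ h' (half_pos (hΛ μ hμ))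
      (half_lt_self (hΛ μ hμ)) hK hb
  · obtain ⟨K, hK, hb⟩ := exists_bound_of_eventually_zero h' (half_pos (hΛ lam hlam))
    exact conv_of_growth_of_bound hf.nonneg hg.nonneg hlam h (half_pos (hΛ lam hlam))
      (half_lt_self (hΛ lam hlam)) hK hb
  · rcases lt_trichotomy lam μ with hlt | rfl | hlt
    · obtain ⟨ν, h1, h2⟩ := exists_between hlt
      obtain ⟨K, hK, hb⟩ := h.exists_pow_bound (hΛ lam hlam).le h1
      rw [hswap]
      exact conv_of_growth_of_bound hg.nonneg hf.nonneg hμ h' ((hΛ lam hlam).trans h1) h2 hK hb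
    · exact ⟨fun n => Finset.sum_nonneg fun x _ => mul_nonneg (hf.nonneg _) (hg.nonneg _),
        Or.inr ⟨lam, hlam, _, h.conv_of_eq h' (hΛ lam hlam) hf.nonneg hg.nonneg⟩⟩
    · obtain ⟨ν, h1, h2⟩ := exists_between hlt
      obtain ⟨K, hK, hb⟩ := h'.exists_pow_bound (hΛ μ hμ).le h1
      exact conv_of_growth_of_bound hf.nonneg hg.nonneg hlam h ((hΛ μ hμ).trans h1) h2 hK hb

end IsZeroOrHasGrowth

/-! ### Perron–Frobenius theory for primitive matrices -/

theorem exists_pos_forall_mul_le {ι : Type*} [Finite ι] {z w : ι → ℝ} (hz : ∀ i, 0 < z i)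
    (hw : ∀ i, 0 < w i) : ∃ ε, 0 < ε ∧ ∀ i, ε * z i ≤ w i := by
  cases isEmpty_or_nonempty ι
  · exact ⟨1, one_pos, fun i => isEmptyElim i⟩
  · obtain ⟨a, ha⟩ := Finite.exists_min fun i => w i / z i
    exact ⟨w a / z a, div_pos (hw a) (hz a), fun i => (le_div_iff₀ (hz i)).1 (ha i)⟩

namespace Matrix

variable {ι : Type*} [Fintype ι]

theorem mulVec_pos_of_pos {A : Matrix ι ι ℝ} (hA : ∀ i j, 0 < A i j) {y : ι → ℝ}
    (hy : ∀ i, 0 ≤ y i) (hy0 : y ≠ 0) (i : ι) : 0 < (A *ᵥ y) i := by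
  obtain ⟨j, hj⟩ := Function.ne_iff.1 hy0
  exact Finset.sum_pos' (fun k _ => mul_nonneg (hA i k).le (hy k))
    ⟨j, Finset.mem_univ j, mul_pos (hA i j) (lt_of_le_of_ne (hy j) (Ne.symm hj))⟩

/-- The maximum in the Collatz–Wielandt formula is attained. -/
theorem exists_collatzWielandt_max [Nonempty ι] {A : Matrix ι ι ℝ} (hA : ∀ i j, 0 ≤ A i j) :
    ∃ (t : ℝ) (x : ι → ℝ), 0 ≤ t ∧ (∀ i, 0 ≤ x i) ∧ x ≠ 0 ∧ (∀ i, t * x i ≤ (A *ᵥ x) i) ∧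
      ∀ (s : ℝ) (y : ι → ℝ), 0 ≤ s → (∀ i, 0 ≤ y i) → y ≠ 0 → (∀ i, s * y i ≤ (A *ᵥ y) i) →
        s ≤ t := by
  classical
  -- On the simplex S bounds every admissible t, as summing t * x i ≤ (A x) i over i shows. Hence
  -- the admissible pairs form a compact set.
  let S : ℝ := ∑ i, ∑ j, A i j
  let K : Set (ℝ × (ι → ℝ)) :=
    (Set.Icc 0 S ×ˢ stdSimplex ℝ ι) ∩ {q | ∀ i, q.1 * q.2 i ≤ (A *ᵥ q.2) i}
  have hcl : IsClosed {q : ℝ × (ι → ℝ) | ∀ i, q.1 * q.2 i ≤ (A *ᵥ q.2) i} := by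
    simp only [Set.ofPred_forall]
    refine isClosed_iInter fun i => isClosed_le (by fun_prop) ?_
    simp only [mulVec, dotProduct]
    fun_prop
  have hK : IsCompact K := (isCompact_Icc.prod (isCompact_stdSimplex ℝ ι)).inter_right hcl
  have hS : 0 ≤ S := Finset.sum_nonneg fun i _ => Finset.sum_nonneg fun j _ => hA i j
  have hnn : ∀ y : ι → ℝ, (∀ i, 0 ≤ y i) → ∀ i, 0 ≤ (A *ᵥ y) i := fun y hy i =>
    Finset.sum_nonneg fun j _ => mul_nonneg (hA i j) (hy j)
  have hne : K.Nonempty := by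
    refine ⟨(0, Pi.single (Classical.arbitrary ι) 1), ⟨⟨le_rfl, hS⟩, single_mem_stdSimplex ℝ _⟩, ?_⟩
    intro i
    rw [zero_mul]
    exact hnn _ (single_mem_stdSimplex ℝ (Classical.arbitrary ι)).1 i
  obtain ⟨⟨t, x⟩, ⟨⟨ht, hx⟩, hle⟩, hmax⟩ := hK.exists_isMaxOn hne continuous_fst.continuousOn
  refine ⟨t, x, ht.1, hx.1, ?_, hle, fun s y hs hy hy0 hsy => ?_⟩
  · rintro rfl
    simpa using hx.2
  · have hy1 : 0 < ∑ i, y i := by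
      obtain ⟨j, hj⟩ := Function.ne_iff.1 hy0
      exact Finset.sum_pos' (fun k _ => hy k)
        ⟨j, Finset.mem_univ j, lt_of_le_of_ne (hy j) (Ne.symm hj)⟩
    set a := ∑ i, y i with ha
    have hz : a⁻¹ • y ∈ stdSimplex ℝ ι := by
      refine ⟨fun i => mul_nonneg (inv_pos.2 hy1).le (hy i), ?_⟩
      simp only [Pi.smul_apply, smul_eq_mul, ← Finset.mul_sum]
      exact inv_mul_cancel₀ hy1.ne'
    have hsz : ∀ i, s * (a⁻¹ • y) i ≤ (A *ᵥ (a⁻¹ • y)) i := fun i => by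
      rw [mulVec_smul, Pi.smul_apply, Pi.smul_apply, smul_eq_mul, smul_eq_mul, mul_left_comm]
      exact mul_le_mul_of_nonneg_left (hsy i) (inv_pos.2 hy1).le
    refine @hmax (s, a⁻¹ • y) ⟨⟨⟨hs, ?_⟩, hz⟩, hsz⟩
    calc s = ∑ i, s * (a⁻¹ • y) i := by rw [← Finset.mul_sum, hz.2, mul_one]
      _ ≤ ∑ i, (A *ᵥ (a⁻¹ • y)) i := Finset.sum_le_sum fun i _ => hsz i
      _ ≤ S := Finset.sum_le_sum fun i _ => Finset.sum_le_sum fun j _ =>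
          mul_le_of_le_one_right (hA i j) (by
            rw [← hz.2]
            exact Finset.single_le_sum (fun k _ => hz.1 k) (Finset.mem_univ j))

variable [DecidableEq ι]

theorem pow_nonneg_of_nonneg {A : Matrix ι ι ℝ} (hA : ∀ i j, 0 ≤ A i j) (n : ℕ) (i j : ι) :
    0 ≤ (A ^ n) i j := by
  induction n generalizing j with
  | zero => rw [pow_zero, one_apply]; split_ifs <;> norm_num
  | succ n ih =>
    rw [pow_succ, mul_apply]
    exact Finset.sum_nonneg fun l _ => mul_nonneg (ih l) (hA l j)

theorem map_natCast_pow (A : Matrix ι ι ℕ) (n : ℕ) :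
    A.map (Nat.cast : ℕ → ℝ) ^ n = (A ^ n).map (Nat.cast : ℕ → ℝ) :=
  (map_pow (Nat.castRingHom ℝ).mapMatrix A n).symm

theorem pow_mulVec_of_mulVec_eq_smul {R : Type*} [CommSemiring R] {A : Matrix ι ι R} {v : ι → R}
    {μ : R} (h : A *ᵥ v = μ • v) (n : ℕ) : (A ^ n) *ᵥ v = μ ^ n • v := by
  induction n with
  | zero => simp
  | succ n ih => rw [pow_succ, ← mulVec_mulVec, h, mulVec_smul, ih, smul_smul, pow_succ']

/-- A primitive matrix has a positive eigenvector with positive eigenvalue. -/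
theorem IsPrimitive.exists_pos_eigenvector [Nonempty ι] {A : Matrix ι ι ℝ} (hA : A.IsPrimitive) :
    ∃ (μ : ℝ) (v : ι → ℝ), 0 < μ ∧ (∀ i, 0 < v i) ∧ A *ᵥ v = μ • v := by
  obtain ⟨t, x, ht, hx, hx0, hle, hmax⟩ := exists_collatzWielandt_max hA.nonneg
  obtain ⟨N, hN, hP⟩ := hA.exists_pos_pow
  have hPx := mulVec_pos_of_pos hP hx hx0
  have heig : A *ᵥ x = t • x := by
    by_contra hne
    have hw := mulVec_pos_of_pos hP (y := A *ᵥ x - t • x)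
      (fun i => sub_nonneg.2 (hle i)) (sub_ne_zero.2 hne)
    obtain ⟨ε, hε, hεle⟩ := exists_pos_forall_mul_le hPx hw
    have h1 := hmax (t + ε) ((A ^ N) *ᵥ x) (by positivity) (fun i => (hPx i).le)
      (fun h0 => (hPx (Classical.arbitrary ι)).ne' (congrFun h0 _)) fun i => by
        have h2 := hεle i
        rw [mulVec_sub, mulVec_smul, mulVec_mulVec, ← pow_succ, pow_succ', ← mulVec_mulVec,
          Pi.sub_apply, Pi.smul_apply, smul_eq_mul] at h2
        linarith
    linarith
  have hpow : ∀ i, 0 < t ^ N * x i := fun i => by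
    have := hPx i
    rwa [pow_mulVec_of_mulVec_eq_smul heig] at this
  have hxp : ∀ i, 0 < x i := fun i => pos_of_mul_pos_right (hpow i) (by positivity)
  refine ⟨t, x, ht.lt_of_ne ?_, hxp, heig⟩
  rintro rfl
  have := hpow (Classical.arbitrary ι)
  rw [zero_pow hN.ne', zero_mul] at this
  exact lt_irrefl _ this

/-- Everything is read off the identity (A^n v)_a = μ^n v_a: one term of this sum gives the upper
bound. For the lower bound, column b of the positive power A ^ N dominates ε v, and A^k (ε v) is
known exactly. -/
theorem IsPrimitive.hasGrowth_pow_apply {A : Matrix ι ι ℝ} (hA : A.IsPrimitive) {μ : ℝ} {v : ι → ℝ}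
    (hμ : 0 < μ) (hv : ∀ i, 0 < v i) (h : A *ᵥ v = μ • v) (a b : ι) :
    HasGrowth (fun n => (A ^ n) a b) 0 μ := by
  obtain ⟨N, -, hP⟩ := hA.exists_pos_pow
  have hnn := pow_nonneg_of_nonneg hA.nonneg
  have hsum : ∀ n, ∑ l, (A ^ n) a l * v l = μ ^ n * v a := fun n =>
    congrFun (pow_mulVec_of_mulVec_eq_smul h n) a
  refine ⟨⟨v a / v b, div_pos (hv a) (hv b), fun n => ?_⟩, ?_⟩
  · rw [pow_zero, one_mul, div_mul_eq_mul_div, le_div_iff₀ (hv b), mul_comm (v a), ← hsum]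
    exact Finset.single_le_sum (f := fun l => (A ^ n) a l * v l)
      (fun l _ => mul_nonneg (hnn n a l) (hv l).le) (Finset.mem_univ b)
  · obtain ⟨ε, hε, hle⟩ := exists_pos_forall_mul_le hv (fun l => hP l b)
    refine ⟨ε * v a / μ ^ N, by have := hv a; positivity, N, fun n hn => ?_⟩
    obtain ⟨k, rfl⟩ := Nat.exists_eq_add_of_le' hn
    calc ε * v a / μ ^ N * ((((k + N : ℕ) : ℝ) + 1) ^ 0 * μ ^ (k + N))
        = ε * (μ ^ k * v a) := by rw [pow_add]; field_simp
      _ = ∑ l, (A ^ k) a l * (ε * v l) := by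
          rw [← hsum, Finset.mul_sum]
          exact Finset.sum_congr rfl fun l _ => by ring
      _ ≤ ∑ l, (A ^ k) a l * (A ^ N) l b :=
          Finset.sum_le_sum fun l _ => mul_le_mul_of_nonneg_left (hle l) (hnn k a l)
      _ = (A ^ (k + N)) a b := by rw [pow_add, mul_apply]

/-- The powers of a primitive natural matrix grow like the powers of an eigenvalue at least `1`. -/
theorem exists_hasGrowth_of_isPrimitive_map_natCast [Nonempty ι] {A : Matrix ι ι ℕ}
    (hA : (A.map (Nat.cast : ℕ → ℝ)).IsPrimitive) :
    ∃ μ : ℝ, 1 ≤ μ ∧ (A.map (Nat.cast : ℕ → ℝ)).charpoly.IsRoot μ ∧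
      ∀ a b, HasGrowth (fun n => ((A.map (Nat.cast : ℕ → ℝ)) ^ n) a b) 0 μ := by
  obtain ⟨μ, v, hμ, hv, h⟩ := hA.exists_pos_eigenvector
  refine ⟨μ, ?_, ?_, fun a b => hA.hasGrowth_pow_apply hμ hv h a b⟩
  · obtain ⟨N, hN, hP⟩ := hA.exists_pos_pow
    have a : ι := Classical.arbitrary ι
    -- Integrality enters here: a positive natural entry is at least 1, and comparison with the
    -- eigenvector equation turns this into μ ^ N ≥ 1.
    have h1 : (1 : ℝ) ≤ ((A.map (Nat.cast : ℕ → ℝ)) ^ N) a a := by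
      have := hP a a
      rw [map_natCast_pow, map_apply] at this ⊢
      exact_mod_cast this
    have h2 : ∑ l, ((A.map (Nat.cast : ℕ → ℝ)) ^ N) a l * v l = μ ^ N * v a :=
      congrFun (pow_mulVec_of_mulVec_eq_smul h N) a
    have h3 : ((A.map (Nat.cast : ℕ → ℝ)) ^ N) a a * v a ≤ μ ^ N * v a := by
      rw [← h2]
      exact Finset.single_le_sum (f := fun l => ((A.map (Nat.cast : ℕ → ℝ)) ^ N) a l * v l)
        (fun l _ => mul_nonneg (hP a l).le (hv l).le) (Finset.mem_univ a)
    have h4 : 1 ≤ μ ^ N := h1.trans (le_of_mul_le_mul_right h3 (hv a))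
    exact (one_le_pow_iff_of_nonneg hμ.le hN.ne').1 h4
  · rw [← mem_spectrum_iff_isRoot_charpoly, ← spectrum_toLin']
    refine Module.End.HasEigenvalue.mem_spectrum
      (Module.End.hasEigenvalue_of_hasEigenvector (x := v) ⟨?_, ?_⟩)
    · rw [Module.End.mem_eigenspace_iff, toLin'_apply, h]
    · intro h0
      exact (hv (Classical.arbitrary ι)).ne' (congrFun h0 _)

end Matrix

/-! ### Powers of block triangular matrices -/

namespace Matrix

/-- With B a diagonal block of A extended by zero, and a starting row in that block, this splits
paths by their first step outside the block: x.1 steps in B, one step of A - B, then x.2 arbitrary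
steps. -/
theorem pow_succ_eq_add_sum_antidiagonal {R : Type*} [Ring R] (A B : R) (n : ℕ) :
    A ^ (n + 1) = B ^ (n + 1) +
      ∑ x ∈ Finset.HasAntidiagonal.antidiagonal n, B ^ x.1 * (A - B) * A ^ x.2 := by
  induction n with
  | zero => simp
  | succ n ih =>
    rw [Finset.Nat.sum_antidiagonal_succ]
    simp only [pow_zero, one_mul, pow_succ' B, mul_assoc]
    rw [← Finset.mul_sum, pow_succ' A, add_left_comm, ← mul_add]
    simp only [mul_assoc, pow_succ' B] at ih
    rw [← ih]
    noncomm_ring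

variable {ι α : Type*} [Fintype ι] [DecidableEq ι] [DecidableEq α]

/-- The diagonal block of `A` over the value `k` of `b`, extended by zero. -/
def extendedBlock {R : Type*} [Zero R] (A : Matrix ι ι R) (b : ι → α) (k : α) : Matrix ι ι R :=
  of fun i j => if b i = k ∧ b j = k then A i j else 0

theorem extendedBlock_pow_apply {R : Type*} [Semiring R] (A : Matrix ι ι R) (b : ι → α) (k : α)
    (n : ℕ) {i : ι} (hi : b i = k) (j : ι) : (A.extendedBlock b k ^ n) i j =
      if hj : b j = k then (A.toSquareBlock b k ^ n) ⟨i, hi⟩ ⟨j, hj⟩ else 0 := by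
  induction n generalizing j with
  | zero =>
    by_cases hj : b j = k
    · simp [hj, one_apply]
    · have : i ≠ j := fun h => hj (h ▸ hi)
      simp [hj, this]
  | succ n ih =>
    rw [pow_succ, mul_apply]
    by_cases hj : b j = k
    · rw [dif_pos hj, pow_succ, mul_apply,
        ← Finset.sum_filter_of_ne (p := fun l => b l = k),
        Finset.sum_subtype (p := fun l => b l = k)]
      · refine Finset.sum_congr rfl fun l _ => ?_
        rw [ih, dif_pos l.2, extendedBlock, of_apply, if_pos ⟨l.2, hj⟩]
        rfl
      · simp
      · intro l _ hl
        by_contra h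
        rw [ih, dif_neg h, zero_mul] at hl
        exact hl rfl
    · rw [dif_neg hj]
      refine Finset.sum_eq_zero fun l _ => ?_
      rw [extendedBlock, of_apply, if_neg fun h => hj h.2, mul_zero]

theorem BlockTriangular.isRoot_charpoly [LinearOrder α] {A : Matrix ι ι ℝ} {b : ι → α}
    (hA : A.BlockTriangular b) (i : ι) {μ : ℝ} (h : (A.toSquareBlock b (b i)).charpoly.IsRoot μ) :
    A.charpoly.IsRoot μ := by
  rw [hA.charpoly]
  refine h.dvd ?_
  convert Finset.dvd_prod_of_mem (fun a => (A.toSquareBlock b a).charpoly)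
    (Finset.mem_image_of_mem b (Finset.mem_univ i))

/-- The growth rates allowed for the entries of the powers of `A`. -/
def growthRates (A : Matrix ι ι ℕ) : Set ℝ :=
  {lam | 1 ≤ lam ∧ (A.map (Nat.cast : ℕ → ℝ)).charpoly.IsRoot lam}

/-- Induction from the last block downwards: nonzero entries lead only to the same or a later block,
so a path leaving block k continues in a strictly larger one, where the induction hypothesis
applies. -/
theorem isZeroOrHasGrowth_pow_apply_of_blockTriangular [LinearOrder α] [Finite α]
    {A : Matrix ι ι ℕ} {b : ι → α} (hA : (A.map (Nat.cast : ℕ → ℝ)).BlockTriangular b)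
    (hb : ∀ k, ((A.map (Nat.cast : ℕ → ℝ)).toSquareBlock b k).IsPrimitive ∨
      (A.map (Nat.cast : ℕ → ℝ)).toSquareBlock b k = 0) (i j : ι) :
    IsZeroOrHasGrowth A.growthRates fun n => ((A.map (Nat.cast : ℕ → ℝ)) ^ n) i j := by
  have hΛ : ∀ lam ∈ A.growthRates, 0 < lam := fun lam h => one_pos.trans_le h.1
  suffices H : ∀ (k : α) (i : ι), b i = k → ∀ j,
      IsZeroOrHasGrowth A.growthRates fun n => ((A.map (Nat.cast : ℕ → ℝ)) ^ n) i j from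
    H _ i rfl j
  intro k
  induction k using (Finite.to_wellFoundedGT (α := α)).wf.induction with
  | _ k ih =>
  intro i hi j
  set D : Matrix ι ι ℝ := A.map (Nat.cast : ℕ → ℝ) with hD
  set B : Matrix ι ι ℝ := D.extendedBlock b k with hB
  have hDnn : ∀ a c, 0 ≤ D a c := fun a c => Nat.cast_nonneg _
  have hblock : ∀ c, IsZeroOrHasGrowth A.growthRates fun n => (B ^ n) i c := by
    intro c
    have hpow := fun n => extendedBlock_pow_apply D b k n hi c
    simp only [hB, hpow]
    by_cases hc : b c = k
    · simp only [dif_pos hc]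
      refine ⟨fun n => pow_nonneg_of_nonneg (fun _ _ => hDnn _ _) n _ _, ?_⟩
      rcases hb k with hk | hk
      · have : Nonempty {a // b a = k} := ⟨⟨i, hi⟩⟩
        obtain ⟨μ, h1, hroot, hg⟩ :=
          exists_hasGrowth_of_isPrimitive_map_natCast (A := A.toSquareBlock b k) hk
        subst hi
        exact Or.inr ⟨μ, ⟨h1, hA.isRoot_charpoly i hroot⟩, 0, hg _ _⟩
      · left
        filter_upwards [eventually_ge_atTop 1] with n hn
        rw [hk, zero_pow (by omega), zero_apply]
    · simpa only [dif_neg hc] using IsZeroOrHasGrowth.zero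
  have hrest : IsZeroOrHasGrowth A.growthRates fun n => (D ^ n - B ^ n) i j := by
    refine IsZeroOrHasGrowth.of_succ hΛ (by simp) ?_
    have hexp : ∀ n, (D ^ (n + 1) - B ^ (n + 1)) i j = ∑ a, ∑ c, (D - B) a c *
        ∑ x ∈ Finset.HasAntidiagonal.antidiagonal n, (B ^ x.1) i a * (D ^ x.2) c j := by
      intro n
      rw [pow_succ_eq_add_sum_antidiagonal D B n, add_sub_cancel_left, sum_apply]
      simp only [mul_apply, Finset.mul_sum, Finset.sum_mul]
      refine Finset.sum_comm.trans ((Finset.sum_congr rfl fun c _ => Finset.sum_comm).trans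
        (Finset.sum_comm.trans ?_))
      exact Finset.sum_congr rfl fun a _ => Finset.sum_congr rfl fun c _ =>
        Finset.sum_congr rfl fun x _ => by ring
    simp only [hexp]
    refine IsZeroOrHasGrowth.sum hΛ _ fun a _ => IsZeroOrHasGrowth.sum hΛ _ fun c _ => ?_
    by_cases ha : b a = k
    -- Only exits to a later block contribute: entries to an earlier block vanish by triangularity,
    -- and inside block k the two matrices cancel.
    · rcases lt_trichotomy (b c) k with hc | hc | hc
      · have h0 : (D - B) a c = 0 := by
          rw [sub_apply, hB, extendedBlock, of_apply, if_neg fun h => hc.ne h.2, sub_zero]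
          exact hA (hc.trans_eq ha.symm)
        simpa only [h0, zero_mul] using IsZeroOrHasGrowth.zero
      · have h0 : (D - B) a c = 0 := by
          rw [sub_apply, hB, extendedBlock, of_apply, if_pos ⟨ha, hc⟩, sub_self]
        simpa only [h0, zero_mul] using IsZeroOrHasGrowth.zero
      · refine ((hblock a).conv hΛ (ih (b c) hc c rfl j)).const_mul ?_
        rw [sub_apply, hB, extendedBlock, of_apply, if_neg fun h => hc.ne' h.2, sub_zero]
        exact hDnn a c
    · have h0 : ∀ n, (B ^ n) i a = 0 := fun n => by
        rw [hB, extendedBlock_pow_apply D b k n hi a, dif_neg ha]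
      simpa only [h0, zero_mul, Finset.sum_const_zero, mul_zero] using IsZeroOrHasGrowth.zero
  simpa only [sub_apply, add_sub_cancel] using (hblock j).add hΛ hrest

theorem IsPermTriangularPrimitive.isZeroOrHasGrowth_pow_apply {m : ℕ}
    {A : Matrix (Fin m) (Fin m) ℕ} (hA : (A.map (Nat.cast : ℕ → ℝ)).IsPermTriangularPrimitive)
    (i j : Fin m) :
    IsZeroOrHasGrowth A.growthRates fun n => ((A.map (Nat.cast : ℕ → ℝ)) ^ n) i j := by
  obtain ⟨σ, h, b, -, -, htri, hblk⟩ := hA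
  have hblk' : ∀ k, (((A.submatrix σ σ).map (Nat.cast : ℕ → ℝ)).toSquareBlock b k).IsPrimitive ∨
      ((A.submatrix σ σ).map (Nat.cast : ℕ → ℝ)).toSquareBlock b k = 0 := fun k =>
    (hblk k).imp_right And.right
  have key : ∀ i j, IsZeroOrHasGrowth (A.submatrix σ σ).growthRates
      fun n => (((A.submatrix σ σ).map (Nat.cast : ℕ → ℝ)) ^ n) i j := fun i j => by
    rcases htri with htri | htri
    · exact isZeroOrHasGrowth_pow_apply_of_blockTriangular htri hblk' i j
    -- The other triangular shape is the same statement for the reversed order on blocks.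
    · exact isZeroOrHasGrowth_pow_apply_of_blockTriangular (b := OrderDual.toDual ∘ b) htri
        (fun k => hblk' (OrderDual.ofDual k)) i j
  have hrates : (A.submatrix σ σ).growthRates = A.growthRates := by
    have := charpoly_reindex σ.symm (A.map (Nat.cast : ℕ → ℝ))
    simp only [growthRates]
    rw [← this]
    rfl
  have hpow : ∀ n, ((A.submatrix σ σ).map (Nat.cast : ℕ → ℝ)) ^ n =
      ((A.map (Nat.cast : ℕ → ℝ)) ^ n).submatrix σ σ := fun n =>
    (map_pow (reindexAlgEquiv ℝ ℝ σ.symm) (A.map (Nat.cast : ℕ → ℝ)) n).symm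
  simpa [hrates, hpow] using key (σ.symm i) (σ.symm j)

end Matrix

/-! ### Passage to the residue classes modulo p -/

theorem mainTheorem5 {m : ℕ} (M : Matrix (Fin m) (Fin m) ℕ) (p : ℕ)
    (hp : p = (M.map (Nat.cast : ℕ → ℝ)).primitivePeriod) (i j : Fin m) (r : ℕ) (hr : r < p) :
    (∀ᶠ n : ℕ in atTop, (M ^ (p * n + r)) i j = 0) ∨
      ∃ (lam : ℝ) (d : ℕ), 1 ≤ lam ∧
        (lam : ℂ) ∈ ((M ^ p).map (Nat.cast : ℕ → ℂ)).Spec ∧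
        (fun n : ℕ => ((M ^ (p * n + r)) i j : ℝ)) =Θ[atTop]
          (fun n : ℕ => (n : ℝ) ^ d * lam ^ n) := by
  have hper : ((M ^ p).map (Nat.cast : ℕ → ℝ)).IsPermTriangularPrimitive := by
    rw [← Matrix.map_natCast_pow, hp]
    exact (Matrix.isLeast_primitivePeriod (M := M.map (Nat.cast : ℕ → ℝ))
      fun i j => Nat.cast_nonneg _).1.2
  -- Since M^(pn+r) = (M^p)^n M^r, the entry is a fixed nonnegative combination of entries of powers
  -- of M^p.
  have hexp : ∀ n, ((M ^ (p * n + r)) i j : ℝ) =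
      ∑ l, ((M ^ r) l j : ℝ) * (((M ^ p).map (Nat.cast : ℕ → ℝ)) ^ n) i l := fun n => by
    rw [Matrix.map_natCast_pow, pow_add, pow_mul, Matrix.mul_apply]
    push_cast
    exact Finset.sum_congr rfl fun l _ => mul_comm _ _
  have hΛ : ∀ lam ∈ (M ^ p).growthRates, 0 < lam := fun lam h => one_pos.trans_le h.1
  have hgrow : IsZeroOrHasGrowth (M ^ p).growthRates
      fun n => ((M ^ (p * n + r)) i j : ℝ) := by
    simp only [hexp]
    exact IsZeroOrHasGrowth.sum hΛ _ fun l _ =>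
      (hper.isZeroOrHasGrowth_pow_apply i l).const_mul (Nat.cast_nonneg _)
  rcases hgrow.zero_or_growth with h | ⟨lam, hlam, d, h⟩
  · left
    filter_upwards [h] with n hn
    exact_mod_cast hn
  · refine Or.inr ⟨lam, d, hlam.1, ?_, h.isTheta (hΛ lam hlam) hgrow.nonneg⟩
    have hmap : (M ^ p).map (Nat.cast : ℕ → ℂ) =
        ((M ^ p).map (Nat.cast : ℕ → ℝ)).map (algebraMap ℝ ℂ) := by
      ext a c
      simp
    rw [Matrix.Spec, Polynomial.mem_roots (Matrix.charpoly_monic _).ne_zero, hmap,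
      Matrix.charpoly_map]
    exact hlam.2.map
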